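/- For real $a$ with $-\pi<a<\pi$ put \[ F(a)=\int_0^1 \frac{\ln\ln(1/y)\,\sin a}{1+2y\cos a+y^2}\,dy . \] This integral, and each integral below, converges absolutely, and \[ F(a)=\frac{\pi}{2}\ln\left(\frac{(2\pi)^{a/\pi}\,\Gamma\left(\frac12+\frac{a}{2\pi}\right)}{\Gamma\left(\frac12-\frac{a}{2\pi}\right)}\right)\qquad(-\pi<a<\pi). \] In particular, $a=\frac{\pi}{2}$ gives Vardi's integral \[ \int_0^1\frac{\ln\ln(1/y)}{1+y^2}\,dy=\frac{\pi}{2}\ln\left(\frac{\sqrt{2\pi}\,\Gamma(3/4)}{\Gamma(1/4)}\right), \] $a=\frac{\pi}{3}$ gives \[ \int_0^1\frac{\ln\ln(1/y)}{1+y+y^2}\,dy=\frac{\pi}{\sqrt3}\ln\left(\frac{(2\pi)^{1/3}\,\Gamma(2/3)}{\Gamma(1/3)}\right), \] and $a=\frac{2\pi}{3}$ gives \[ \int_0^1\frac{\ln\ln(1/y)}{1-y+y^2}\,dy=\frac{\pi}{\sqrt3}\ln\left(\frac{(2\pi)^{2/3}\,\Gamma(5/6)}{\Gamma(1/6)}\right)=\frac{2\pi}{\sqrt3}\left[\frac56\ln(2\pi)-\ln\Gamma\left(\frac16\right)\right].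 \] -/

import Mathlib

open Real MeasureTheory

open Set Filter Topology

/-! Substituting `y = exp (-t)` turns F(a) into the integral over `t > 0` of `log t` times `sin a /
(2 * (cosh t + cos a))`. The second factor is half the real part of a cotangent, so Euler's
expansion writes it as the sum over k of K((2k+1)π - a) - K((2k+1)π + a), where K(x) = x / (t² +
x²). Each kernel integrates against `log t` to (π/2) log x, and the resulting sum of logarithms is
what Euler's limit for `log Gamma` evaluates.

That sum diverges like (a/π) log N, so summing and integrating cannot be exchanged directly. Each
term is therefore corrected by a telescoping difference whose total is (a/π) K(2πN): it tends to 0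
for fixed t, yet its integral against `log t` supplies the missing logarithm. The corrected terms
are O(1/k²) uniformly against 1/(1+t²) (`exists_abs_compensatedTerm_le`), and dominated convergence
applies. -/

/-- The Cauchy-type kernel `x / (t² + x²)`. -/
noncomputable def cauchyKernel (t x : ℝ) : ℝ := x / (t ^ 2 + x ^ 2)

/-- A pair of poles in the partial fraction expansion of `sin a / (2 (cosh t + cos a))`, together
with a compensating term which telescopes. -/
noncomputable def compensatedTerm (a : ℝ) (k : ℕ) (t : ℝ) : ℝ :=
  cauchyKernel t ((2 * k + 1) * π - a) - cauchyKernel t ((2 * k + 1) * π + a) +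
    a / π * (cauchyKernel t (2 * π * (k + 1)) - cauchyKernel t (2 * π * k))

/-! ### Uniform bounds for the compensated terms -/

theorem cauchyKernel_nonneg {t x : ℝ} (hx : 0 ≤ x) : 0 ≤ cauchyKernel t x := by
  unfold cauchyKernel; positivity

theorem cauchyKernel_le {t x : ℝ} (hx : 0 < x) :
    cauchyKernel t x ≤ (x + 1 / x) * (1 + t ^ 2)⁻¹ := by
  unfold cauchyKernel
  rw [← div_eq_mul_inv, div_le_div_iff₀ (by positivity) (by positivity)]
  have h : (x + 1 / x) * (t ^ 2 + x ^ 2) - x * (1 + t ^ 2) = t ^ 2 / x + x ^ 3 := by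
    field_simp; ring
  have : 0 ≤ t ^ 2 / x + x ^ 3 := by positivity
  linarith

theorem abs_cauchyKernel_le {t x : ℝ} (hx : 0 ≤ x) :
    |cauchyKernel t x| ≤ (x + 1 / x) * (1 + t ^ 2)⁻¹ := by
  rw [abs_of_nonneg (cauchyKernel_nonneg hx)]
  rcases hx.eq_or_lt with rfl | hx
  · simp [cauchyKernel]
  · exact cauchyKernel_le hx

/-- The term k = 0 is separate because its centre m = π violates the condition 3π ≤ m of the general
estimate; its kernel at 0 vanishes identically. -/
theorem abs_compensatedTerm_zero_le {a : ℝ} (h1 : -π < a) (h2 : a < π) :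
    ∃ C, 0 ≤ C ∧ ∀ t, |compensatedTerm a 0 t| ≤ C * (1 + t ^ 2)⁻¹ := by
  have hb : 0 < π - a := by linarith
  have hc : 0 < π + a := by linarith
  refine ⟨((π - a) + 1 / (π - a)) + ((π + a) + 1 / (π + a)) +
    |a / π| * (2 * π + 1 / (2 * π)), by positivity, fun t => ?_⟩
  have e : compensatedTerm a 0 t = cauchyKernel t (π - a) - cauchyKernel t (π + a) +
      a / π * cauchyKernel t (2 * π) := by
    simp [compensatedTerm, cauchyKernel]
  rw [e, add_mul, add_mul, mul_assoc |a / π|]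
  refine (abs_add_le _ _).trans (add_le_add ((abs_sub _ _).trans (add_le_add ?_ ?_)) ?_)
  · exact abs_cauchyKernel_le hb.le
  · exact abs_cauchyKernel_le hc.le
  · rw [abs_mul]
    exact mul_le_mul_of_nonneg_left (abs_cauchyKernel_le (by positivity)) (abs_nonneg _)

/-- With m = (2k+1)π and p = π this is a compensated term. The compensator cancels the part linear
in a, so over the common denominator the numerator has degree only 4 in (t, m) against degree 8
below. -/
theorem second_difference_cauchyKernel {a m t p : ℝ} (hp : p ≠ 0)
    (h1 : t ^ 2 + (m - a) ^ 2 ≠ 0) (h2 : t ^ 2 + (m + a) ^ 2 ≠ 0)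
    (h3 : t ^ 2 + (m - p) ^ 2 ≠ 0) (h4 : t ^ 2 + (m + p) ^ 2 ≠ 0) :
    cauchyKernel t (m - a) - cauchyKernel t (m + a) +
        a / p * (cauchyKernel t (m + p) - cauchyKernel t (m - p)) =
      -(2 * a * (p ^ 2 - a ^ 2) * (2 * (t ^ 2 - m ^ 2) ^ 2 - (t ^ 2 + m ^ 2) ^ 2 +
        (t ^ 2 - m ^ 2) * (p ^ 2 + a ^ 2) + a ^ 2 * p ^ 2)) /
      ((t ^ 2 + (m - a) ^ 2) * (t ^ 2 + (m + a) ^ 2) *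
        ((t ^ 2 + (m - p) ^ 2) * (t ^ 2 + (m + p) ^ 2))) := by
  unfold cauchyKernel
  field_simp
  ring

theorem mul_sq_add_sq_ge {a m t p : ℝ} (ha : |a| ≤ p) (hm : 3 * p ≤ m) :
    (1 / 9) * (t ^ 2 + m ^ 2) ^ 2 ≤ (t ^ 2 + (m - a) ^ 2) * (t ^ 2 + (m + a) ^ 2) := by
  obtain ⟨h1, h2⟩ := abs_le.1 ha
  have hp : 0 ≤ p := (abs_nonneg a).trans ha
  -- Since |a| ≤ m/3, m ± a ≥ 2m/3, and 4/9 ≥ 1/3.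
  have e1 : (1 / 3) * (t ^ 2 + m ^ 2) ≤ t ^ 2 + (m - a) ^ 2 := by
    nlinarith [sq_nonneg t, mul_self_nonneg (m - a - 2 / 3 * m),
      mul_nonneg (by linarith : 0 ≤ m - a - 2 / 3 * m) (by linarith : 0 ≤ m), sq_nonneg m]
  have e2 : (1 / 3) * (t ^ 2 + m ^ 2) ≤ t ^ 2 + (m + a) ^ 2 := by
    nlinarith [sq_nonneg t, mul_self_nonneg (m + a - 2 / 3 * m),
      mul_nonneg (by linarith : 0 ≤ m + a - 2 / 3 * m) (by linarith : 0 ≤ m), sq_nonneg m]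
  calc (1 / 9) * (t ^ 2 + m ^ 2) ^ 2 = ((1 / 3) * (t ^ 2 + m ^ 2)) * ((1 / 3) * (t ^ 2 + m ^ 2)) := by
        ring
    _ ≤ _ := mul_le_mul e1 e2 (by positivity) (by positivity)

theorem abs_second_difference_cauchyKernel_le {a m t p : ℝ} (hp : 0 < p) (ha : |a| < p)
    (hm : 3 * p ≤ m) :
    |cauchyKernel t (m - a) - cauchyKernel t (m + a) +
        a / p * (cauchyKernel t (m + p) - cauchyKernel t (m - p))| ≤
      972 * p ^ 3 / (t ^ 2 + m ^ 2) ^ 2 := by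
  obtain ⟨h1, h2⟩ := abs_lt.1 ha
  have i1 : 0 < m - a := by linarith
  have i2 : 0 < m + a := by linarith
  have i3 : 0 < m - p := by linarith
  have i4 : 0 < m + p := by linarith
  have i5 : 0 < m := by linarith
  rw [second_difference_cauchyKernel hp.ne' (by positivity) (by positivity) (by positivity)
    (by positivity), abs_div, abs_neg]
  have hD := mul_le_mul (mul_sq_add_sq_ge (t := t) ha.le hm)
    (mul_sq_add_sq_ge (t := t) (abs_of_pos hp).le hm) (by positivity) (by positivity)
  set D := (t ^ 2 + (m - a) ^ 2) * (t ^ 2 + (m + a) ^ 2) *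
        ((t ^ 2 + (m - p) ^ 2) * (t ^ 2 + (m + p) ^ 2))
  have hDpos : 0 < D := by positivity
  set Q := t ^ 2 + m ^ 2 with hQ
  have hQpos : 0 < Q := by positivity
  have hPQ : |t ^ 2 - m ^ 2| ≤ Q := by
    rw [abs_le]; constructor <;> nlinarith [sq_nonneg t, sq_nonneg m]
  have ha2 : a ^ 2 ≤ p ^ 2 := sq_le_sq' h1.le h2.le
  have hpQ : p ^ 2 ≤ Q := by nlinarith [sq_nonneg t]
  have hP2 : (t ^ 2 - m ^ 2) ^ 2 ≤ Q ^ 2 := sq_le_sq' (abs_le.1 hPQ).1 (abs_le.1 hPQ).2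
  have hN : |2 * (t ^ 2 - m ^ 2) ^ 2 - Q ^ 2 + (t ^ 2 - m ^ 2) * (p ^ 2 + a ^ 2) + a ^ 2 * p ^ 2| ≤
      6 * Q ^ 2 := by
    have j1 : |(t ^ 2 - m ^ 2) * (p ^ 2 + a ^ 2)| ≤ Q * (2 * Q) := by
      rw [abs_mul, abs_of_nonneg (by positivity : 0 ≤ p ^ 2 + a ^ 2)]
      exact mul_le_mul hPQ (by linarith) (by positivity) hQpos.le
    have j2 : a ^ 2 * p ^ 2 ≤ Q * Q :=
      mul_le_mul (ha2.trans hpQ) hpQ (by positivity) hQpos.le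
    have j3 : 0 ≤ a ^ 2 * p ^ 2 := by positivity
    have j4 := abs_le.1 j1
    rw [abs_le]
    constructor <;> nlinarith [sq_nonneg (t ^ 2 - m ^ 2)]
  rw [div_le_div_iff₀ (by positivity) (by positivity), abs_of_pos hDpos]
  rw [abs_mul, abs_mul, abs_mul, abs_two, abs_of_nonneg (by linarith : 0 ≤ p ^ 2 - a ^ 2)]
  -- 972 = 2 · 6 · 81: the prefactor 2, the bound 6Q² from `hN`, and two factors 1/9 from the
  -- denominator.
  calc 2 * |a| * (p ^ 2 - a ^ 2) *
        |2 * (t ^ 2 - m ^ 2) ^ 2 - Q ^ 2 + (t ^ 2 - m ^ 2) * (p ^ 2 + a ^ 2) + a ^ 2 * p ^ 2| * Q ^ 2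
      ≤ 2 * p * p ^ 2 * (6 * Q ^ 2) * Q ^ 2 := by
        gcongr
        nlinarith [sq_nonneg a]
    _ = 972 * p ^ 3 * (1 / 9 * Q ^ 2 * (1 / 9 * Q ^ 2)) := by ring
    _ ≤ 972 * p ^ 3 * D := by gcongr

theorem abs_compensatedTerm_succ_le {a : ℝ} (h1 : -π < a) (h2 : a < π) (k : ℕ) (t : ℝ) :
    |compensatedTerm a (k + 1) t| ≤ 972 * π ^ 3 * (1 + t ^ 2)⁻¹ * (1 / ((k : ℝ) + 2) ^ 2) := by
  have hk : (0 : ℝ) ≤ k := k.cast_nonneg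
  have hpi := pi_gt_three
  have hm : 3 * π ≤ (2 * (k + 1 : ℕ) + 1) * π := by push_cast; nlinarith
  have := abs_second_difference_cauchyKernel_le (t := t) pi_pos (abs_lt.2 ⟨h1, h2⟩) hm
  have e : compensatedTerm a (k + 1) t =
      cauchyKernel t ((2 * (k + 1 : ℕ) + 1) * π - a) -
        cauchyKernel t ((2 * (k + 1 : ℕ) + 1) * π + a) +
        a / π * (cauchyKernel t ((2 * (k + 1 : ℕ) + 1) * π + π) -
          cauchyKernel t ((2 * (k + 1 : ℕ) + 1) * π - π)) := by
    unfold compensatedTerm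
    congr 4 <;> push_cast <;> ring
  rw [e]
  refine this.trans ?_
  set m : ℝ := (2 * (k + 1 : ℕ) + 1) * π with hmdef
  have hm2 : (k : ℝ) + 2 ≤ m := by rw [hmdef]; push_cast; nlinarith
  rw [div_eq_mul_inv, mul_assoc (972 * π ^ 3), one_div, ← mul_inv]
  gcongr
  rw [sq (t ^ 2 + m ^ 2)]
  have : ((k : ℝ) + 2) ^ 2 ≤ m ^ 2 := by gcongr
  apply mul_le_mul <;> nlinarith [sq_nonneg t]

theorem exists_abs_compensatedTerm_le {a : ℝ} (h1 : -π < a) (h2 : a < π) :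
    ∃ C, 0 ≤ C ∧ ∀ (k : ℕ) (t : ℝ),
      |compensatedTerm a k t| ≤ C * (1 + t ^ 2)⁻¹ * (1 / ((k : ℝ) + 1) ^ 2) := by
  obtain ⟨C, hC, h⟩ := abs_compensatedTerm_zero_le h1 h2
  refine ⟨C + 972 * π ^ 3, by positivity, fun k t => ?_⟩
  have : 0 ≤ (1 + t ^ 2)⁻¹ := by positivity
  have hp : 0 ≤ π ^ 3 := by positivity
  cases k with
  | zero =>
    refine (h t).trans ?_
    simp
    gcongr
    linarith
  | succ k =>
    refine (abs_compensatedTerm_succ_le h1 h2 k t).trans ?_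
    push_cast
    rw [show (k : ℝ) + 1 + 1 = k + 2 by ring]
    gcongr
    linarith

theorem exists_abs_sum_compensatedTerm_le {a : ℝ} (h1 : -π < a) (h2 : a < π) :
    ∃ C, 0 ≤ C ∧ ∀ (N : ℕ) (t : ℝ),
      |∑ k ∈ Finset.range N, compensatedTerm a k t| ≤ C * (1 + t ^ 2)⁻¹ := by
  obtain ⟨C, hC, h⟩ := exists_abs_compensatedTerm_le h1 h2
  have hs : Summable fun k : ℕ => 1 / ((k : ℝ) + 1) ^ 2 := by
    have := (summable_nat_add_iff 1).2 (Real.summable_one_div_nat_pow.2 one_lt_two)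
    simpa using this
  refine ⟨C * ∑' k : ℕ, 1 / ((k : ℝ) + 1) ^ 2, by positivity, fun N t => ?_⟩
  refine (Finset.abs_sum_le_sum_abs _ _).trans ((Finset.sum_le_sum fun k _ => h k t).trans ?_)
  rw [← Finset.mul_sum, mul_right_comm]
  gcongr
  exact hs.sum_le_tsum _ fun k _ => by positivity

/-! ### Partial fractions from Euler's cotangent expansion -/

theorem re_one_div_add_mul_I (x t : ℝ) :
    (1 / ((x : ℂ) + t * Complex.I)).re = cauchyKernel t x := by
  simp [cauchyKernel, Complex.normSq_apply]
  ring

theorem re_two_pi_div (x t : ℝ) (z : ℂ) (hz : 2 * π * z = x - t * Complex.I) :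
    (1 / z).re = 2 * π * cauchyKernel t x := by
  have hpi : (π : ℂ) ≠ 0 := by exact_mod_cast pi_ne_zero
  have : 1 / z = (2 * π : ℝ) * (1 / ((x : ℂ) + (-t : ℝ) * Complex.I)) := by
    rw [show (x : ℂ) + (-t : ℝ) * Complex.I = 2 * π * z by rw [hz]; push_cast; ring]
    push_cast
    rcases eq_or_ne z 0 with rfl | hz0
    · simp
    · field_simp
  rw [this, Complex.re_ofReal_mul, re_one_div_add_mul_I]
  simp [cauchyKernel]

/-- The cotangent here is tan((a + it)/2), split into real and imaginary parts by the addition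
formulas. -/
theorem re_cot_eq (a t : ℝ) :
    (Complex.cot (π / 2 - (a + t * Complex.I) / 2)).re = sin a / (cosh t + cos a) := by
  have e : ((a : ℂ) + t * Complex.I) / 2 = ((a / 2 : ℝ) : ℂ) + ((t / 2 : ℝ) : ℂ) * Complex.I := by
    push_cast; ring
  rw [Complex.cot, Complex.cos_pi_div_two_sub, Complex.sin_pi_div_two_sub, e,
    Complex.sin_add_mul_I, Complex.cos_add_mul_I]
  obtain ⟨x, rfl⟩ : ∃ x, a = 2 * x := ⟨a / 2, by ring⟩
  obtain ⟨y, rfl⟩ : ∃ y, t = 2 * y := ⟨t / 2, by ring⟩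
  rw [mul_div_cancel_left₀ _ two_ne_zero, mul_div_cancel_left₀ _ two_ne_zero]
  simp only [← Complex.ofReal_sin, ← Complex.ofReal_cos, ← Complex.ofReal_sinh,
    ← Complex.ofReal_cosh, Complex.div_re, Complex.normSq_apply]
  simp [-Complex.ofReal_sin, -Complex.ofReal_cos, -Complex.ofReal_sinh, -Complex.ofReal_cosh]
  rw [sin_two_mul, cos_two_mul, cosh_two_mul, cosh_sq, ← add_div]
  have h1 : sin x * cosh y * (cos x * cosh y) - cos x * sinh y * (sin x * sinh y) =
      sin x * cos x := by
    linear_combination sin x * cos x * cosh_sq_sub_sinh_sq y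
  have h2 : cos x * cosh y * (cos x * cosh y) + sin x * sinh y * (sin x * sinh y) =
      (sinh y ^ 2 + 1 + sinh y ^ 2 + (2 * cos x ^ 2 - 1)) / 2 := by
    linear_combination cos x ^ 2 * cosh_sq y + sinh y ^ 2 * sin_sq_add_cos_sq x
  rw [show sin x * cosh y * (cos x * cosh y) + -(cos x * sinh y * (sin x * sinh y)) =
      sin x * cos x by linarith, h2]
  field_simp

theorem tendsto_cauchyKernel_atTop (t : ℝ) : Tendsto (cauchyKernel t) atTop (𝓝 0) := by
  refine squeeze_zero' (g := fun x => x⁻¹) ?_ ?_ tendsto_inv_atTop_zero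
  · filter_upwards [eventually_ge_atTop 0] with x hx using cauchyKernel_nonneg hx
  · filter_upwards [eventually_gt_atTop 0] with x hx
    unfold cauchyKernel
    rw [← one_div, div_le_div_iff₀ (by positivity) hx]
    nlinarith [sq_nonneg t]

theorem tendsto_sum_compensatedTerm {a t : ℝ} (ht : 0 < t) :
    Tendsto (fun N : ℕ => ∑ k ∈ Finset.range N, compensatedTerm a k t) atTop
      (𝓝 (sin a / (2 * (cosh t + cos a)))) := by
  have hpi : (π : ℂ) ≠ 0 := by exact_mod_cast pi_ne_zero
  -- Chosen so that 2π(z + n) = (2n+1)π - a - it; t > 0 keeps z off the integers.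
  set z : ℂ := 1 / 2 - (a + t * Complex.I) / (2 * π) with hz
  have hzim : z.im = -(t / (2 * π)) := by
    have : z = ((1 / 2 - a / (2 * π) : ℝ) : ℂ) + ((-(t / (2 * π)) : ℝ) : ℂ) * Complex.I := by
      rw [hz]; push_cast; ring
    rw [this, Complex.add_im, Complex.ofReal_im, Complex.im_ofReal_mul, Complex.I_im]; ring
  have hzmem : z ∈ Complex.integerComplement := by
    rintro ⟨n, hn⟩
    rw [← hn, Complex.intCast_im] at hzim
    have : 0 < t / (2 * π) := by positivity
    linarith
  have hpz : (π : ℂ) * z = π / 2 - (a + t * Complex.I) / 2 := by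
    rw [hz]; field_simp
  have hterm (n : ℕ) : (cotTerm z n).re = 2 * π *
      (cauchyKernel t ((2 * (n + 1 : ℕ) + 1) * π - a) - cauchyKernel t ((2 * n + 1) * π + a)) := by
    rw [cotTerm, Complex.add_re, re_two_pi_div ((2 * (n + 1 : ℕ) + 1) * π - a) t (z + (n + 1))]
    · have : (1 / (z - (n + 1))).re = -(1 / -(z - (n + 1))).re := by
        rw [one_div_neg_eq_neg_one_div, Complex.neg_re, neg_neg]
      rw [this, re_two_pi_div ((2 * n + 1) * π + a) (-t) (-(z - (n + 1)))]
      · simp only [cauchyKernel, neg_sq]; ring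
      · rw [hz]; push_cast; field_simp; ring
    · rw [hz]; push_cast; field_simp; ring
  -- `cotTerm` pairs the poles z + (n+1) and z - (n+1), one step out of phase with
  -- `compensatedTerm`. Hence the boundary kernels: the one at π - a is matched by 1/z, the other
  -- two vanish as N grows.
  have hsum (N : ℕ) : (∑ j ∈ Finset.range N, cotTerm z j).re = 2 * π *
      (∑ k ∈ Finset.range N, compensatedTerm a k t - a / π * cauchyKernel t (2 * π * N) +
        cauchyKernel t ((2 * N + 1) * π - a) - cauchyKernel t (π - a)) := by
    induction N with
    | zero => simp [cauchyKernel]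
    | succ N ih =>
      rw [Finset.sum_range_succ, Complex.add_re, ih, hterm, Finset.sum_range_succ, compensatedTerm]
      push_cast
      ring
  have hz0 : (1 / z).re = 2 * π * cauchyKernel t (π - a) := by
    apply re_two_pi_div
    rw [hz]; push_cast; field_simp; ring
  have hlim := (Complex.continuous_re.tendsto _).comp (tendsto_logDeriv_euler_cot_sub hzmem)
  have hN1 : Tendsto (fun N : ℕ => cauchyKernel t (2 * π * N)) atTop (𝓝 0) :=
    (tendsto_cauchyKernel_atTop t).comp
      (tendsto_natCast_atTop_atTop.const_mul_atTop (by positivity))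
  have hN2 : Tendsto (fun N : ℕ => cauchyKernel t ((2 * N + 1) * π - a)) atTop (𝓝 0) := by
    refine (tendsto_cauchyKernel_atTop t).comp ?_
    refine tendsto_atTop_add_const_right _ _ (Tendsto.atTop_mul_const pi_pos ?_)
    exact tendsto_atTop_add_const_right _ _
      (tendsto_natCast_atTop_atTop.const_mul_atTop two_pos)
  have key := (((hlim.const_mul (1 / (2 * π))).add (hN1.const_mul (a / π))).sub hN2).add_const
    (cauchyKernel t (π - a))
  refine (key.congr fun N => ?_).trans_eq ?_
  · simp only [Function.comp]
    rw [hsum]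
    field_simp
    ring
  · congr 1
    rw [Complex.sub_re, hz0, Complex.re_ofReal_mul, hpz, re_cot_eq]
    field_simp
    ring

/-! ### Integrals of the logarithm against the kernel -/

theorem integrableOn_log_mul_inv_one_add_sq :
    IntegrableOn (fun t : ℝ => log t * (1 + t ^ 2)⁻¹) (Ioi 0) := by
  rw [← Ioc_union_Ioi_eq_Ioi (zero_le_one' ℝ)]
  refine IntegrableOn.union ?_ ?_
  · have h : IntegrableOn log (Ioc (0 : ℝ) 1) :=
      (intervalIntegrable_iff_integrableOn_Ioc_of_le zero_le_one).1
        intervalIntegral.intervalIntegrable_log'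
    refine h.norm.mono' (measurable_log.mul (by fun_prop)).aestronglyMeasurable ?_
    refine Eventually.of_forall fun t => ?_
    rw [norm_mul, norm_of_nonneg (by positivity : 0 ≤ (1 + t ^ 2)⁻¹)]
    exact mul_le_of_le_one_right (norm_nonneg _) (inv_le_one_of_one_le₀ (by nlinarith [sq_nonneg t]))
  · have h : IntegrableOn (fun t : ℝ => 2 * t ^ (-(3 / 2) : ℝ)) (Ioi 1) :=
      (integrableOn_Ioi_rpow_of_lt (by norm_num) one_pos).const_mul 2
    refine h.mono' (measurable_log.mul (by fun_prop)).aestronglyMeasurable ?_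
    filter_upwards [ae_restrict_mem measurableSet_Ioi] with t ht
    have ht1 : (1 : ℝ) < t := ht
    have ht0 : 0 < t := by linarith
    have hl := log_le_rpow_div ht0.le (by norm_num : (0 : ℝ) < 1 / 2)
    rw [norm_mul, norm_of_nonneg (log_nonneg ht1.le), norm_of_nonneg (by positivity)]
    have h2 : (1 + t ^ 2)⁻¹ ≤ t ^ (-2 : ℝ) := by
      rw [rpow_neg ht0.le, rpow_two]
      gcongr
      linarith
    calc log t * (1 + t ^ 2)⁻¹ ≤ t ^ (1 / 2 : ℝ) / (1 / 2) * t ^ (-2 : ℝ) := by gcongr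
      _ = 2 * (t ^ (1 / 2 : ℝ) * t ^ (-2 : ℝ)) := by ring
      _ = 2 * t ^ (-(3 / 2) : ℝ) := by rw [← rpow_add ht0]; norm_num

/-- The inversion t ↦ 1/t preserves dt/(1+t²) and changes the sign of `log t`. -/
theorem integral_log_mul_inv_one_add_sq :
    ∫ t in Ioi (0 : ℝ), log t * (1 + t ^ 2)⁻¹ = 0 := by
  have h := integral_comp_rpow_Ioi (fun t : ℝ => log t * (1 + t ^ 2)⁻¹) (p := -1) (by norm_num)
  have h2 : ∫ x in Ioi (0 : ℝ), (|(-1 : ℝ)| * x ^ ((-1 : ℝ) - 1)) •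
      (log (x ^ (-1 : ℝ)) * (1 + (x ^ (-1 : ℝ)) ^ 2)⁻¹) =
      ∫ x in Ioi (0 : ℝ), -(log x * (1 + x ^ 2)⁻¹) := by
    refine setIntegral_congr_fun measurableSet_Ioi fun x hx => ?_
    have hx0 : 0 < x := hx
    have e : x ^ ((-1 : ℝ) - 1) = (x ^ 2)⁻¹ := by
      rw [show (-1 : ℝ) - 1 = -2 by norm_num, rpow_neg hx0.le, rpow_two]
    simp only [e, rpow_neg_one, log_inv, abs_neg, abs_one, one_mul, smul_eq_mul]
    field_simp
    ring
  rw [h2, integral_neg] at h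
  linarith

theorem log_mul_cauchyKernel_comp_mul {b : ℝ} (hb : 0 < b) {t : ℝ} (ht : 0 < t) :
    log (b * t) * cauchyKernel (b * t) b =
      b⁻¹ * (log t * (1 + t ^ 2)⁻¹ + log b * (1 + t ^ 2)⁻¹) := by
  unfold cauchyKernel
  rw [log_mul hb.ne' ht.ne']
  field_simp
  ring

theorem integrableOn_log_mul_cauchyKernel {b : ℝ} (hb : 0 < b) :
    IntegrableOn (fun t => log t * cauchyKernel t b) (Ioi 0) := by
  rw [← mul_zero b, ← integrableOn_Ioi_comp_mul_left_iff _ _ hb]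
  refine IntegrableOn.congr_fun ?_
    (fun t ht => (log_mul_cauchyKernel_comp_mul hb ht).symm) measurableSet_Ioi
  exact (integrableOn_log_mul_inv_one_add_sq.add
    (integrable_inv_one_add_sq.integrableOn.const_mul _)).const_mul _

theorem integral_log_mul_cauchyKernel {b : ℝ} (hb : 0 < b) :
    ∫ t in Ioi (0 : ℝ), log t * cauchyKernel t b = π / 2 * log b := by
  have h := integral_comp_mul_left_Ioi (fun t => log t * cauchyKernel t b) 0 hb
  rw [setIntegral_congr_fun measurableSet_Ioi
    (fun t ht => log_mul_cauchyKernel_comp_mul hb ht), integral_const_mul, integral_add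
    integrableOn_log_mul_inv_one_add_sq (integrable_inv_one_add_sq.integrableOn.const_mul _),
    integral_log_mul_inv_one_add_sq, integral_const_mul, integral_Ioi_inv_one_add_sq, mul_zero,
    smul_eq_mul, arctan_zero] at h
  have := mul_left_cancel₀ (inv_ne_zero hb.ne') h
  linarith

/-! ### Passage to the limit and the Gamma function -/

theorem sum_compensatedTerm (a : ℝ) (N : ℕ) (t : ℝ) :
    ∑ k ∈ Finset.range N, compensatedTerm a k t =
      ∑ k ∈ Finset.range N, (cauchyKernel t ((2 * k + 1) * π - a) -
        cauchyKernel t ((2 * k + 1) * π + a)) + a / π * cauchyKernel t (2 * π * N) := by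
  induction N with
  | zero => simp [cauchyKernel]
  | succ N ih =>
    rw [Finset.sum_range_succ, ih, Finset.sum_range_succ, compensatedTerm]
    push_cast
    ring

theorem integral_log_mul_sum_compensatedTerm {a : ℝ} (h1 : -π < a) (h2 : a < π) (n : ℕ) :
    ∫ t in Ioi (0 : ℝ), log t * ∑ k ∈ Finset.range (n + 1), compensatedTerm a k t =
      π / 2 * (∑ k ∈ Finset.range (n + 1),
        (log ((2 * k + 1) * π - a) - log ((2 * k + 1) * π + a)) +
          a / π * log (2 * π * (n + 1))) := by
  have hb (k : ℕ) : 0 < (2 * k + 1) * π - a := by nlinarith [pi_pos, k.cast_nonneg (α := ℝ)]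
  have hc (k : ℕ) : 0 < (2 * k + 1) * π + a := by nlinarith [pi_pos, k.cast_nonneg (α := ℝ)]
  have hn : 0 < 2 * π * (n + 1 : ℕ) := by positivity
  simp_rw [sum_compensatedTerm, mul_add, Finset.mul_sum, mul_sub, mul_left_comm (log _) (a / π)]
  have hI (k : ℕ) : IntegrableOn (fun t => log t * cauchyKernel t ((2 * k + 1) * π - a) -
      log t * cauchyKernel t ((2 * k + 1) * π + a)) (Ioi 0) := (integrableOn_log_mul_cauchyKernel (hb k)).sub
    (integrableOn_log_mul_cauchyKernel (hc k))
  rw [integral_add (integrable_finsetSum _ fun k _ => hI k)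
    ((integrableOn_log_mul_cauchyKernel hn).const_mul _), integral_finsetSum _ fun k _ => hI k,
    integral_const_mul, integral_log_mul_cauchyKernel hn]
  congr 1
  · refine Finset.sum_congr rfl fun k _ => ?_
    rw [integral_sub (integrableOn_log_mul_cauchyKernel (hb k))
      (integrableOn_log_mul_cauchyKernel (hc k)), integral_log_mul_cauchyKernel (hb k),
      integral_log_mul_cauchyKernel (hc k)]
  · push_cast; rw [mul_add]; ring

/-- `logGammaSeq x n` is x log n + log n! minus n + 1 logarithms. In the difference the factorials
cancel and (a/π) log n remains, whereas the compensator gives log(n+1); the discrepancy tends to 0.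
-/
theorem sum_log_sub_log_eq {a : ℝ} (h1 : -π < a) (h2 : a < π) (n : ℕ) :
    ∑ k ∈ Finset.range (n + 1), (log ((2 * k + 1) * π - a) - log ((2 * k + 1) * π + a)) +
      a / π * log (2 * π * (n + 1)) =
    BohrMollerup.logGammaSeq (1 / 2 + a / (2 * π)) n -
      BohrMollerup.logGammaSeq (1 / 2 - a / (2 * π)) n +
      a / π * (log (2 * π) + (log (n + 1) - log n)) := by
  have hk (k : ℕ) : log ((2 * k + 1) * π - a) - log ((2 * k + 1) * π + a) =
      log (1 / 2 - a / (2 * π) + k) - log (1 / 2 + a / (2 * π) + k) := by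
    have hb : 0 < (2 * k + 1) * π - a := by nlinarith [pi_pos, k.cast_nonneg (α := ℝ)]
    have hc : 0 < (2 * k + 1) * π + a := by nlinarith [pi_pos, k.cast_nonneg (α := ℝ)]
    rw [show 1 / 2 - a / (2 * π) + k = ((2 * k + 1) * π - a) / (2 * π) by field_simp; ring,
      show 1 / 2 + a / (2 * π) + k = ((2 * k + 1) * π + a) / (2 * π) by field_simp; ring,
      log_div hb.ne' (by positivity), log_div hc.ne' (by positivity)]
    ring
  simp_rw [hk, Finset.sum_sub_distrib, BohrMollerup.logGammaSeq]
  rw [log_mul (by positivity : 2 * π ≠ 0) (by positivity)]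
  field_simp
  ring

theorem integral_log_mul_sin_div_cosh {a : ℝ} (h1 : -π < a) (h2 : a < π) :
    IntegrableOn (fun t => log t * (sin a / (2 * (cosh t + cos a)))) (Ioi 0) ∧
    ∫ t in Ioi (0 : ℝ), log t * (sin a / (2 * (cosh t + cos a))) =
      π / 2 * log ((2 * π) ^ (a / π) * Gamma (1 / 2 + a / (2 * π))
          / Gamma (1 / 2 - a / (2 * π))) := by
  obtain ⟨C, hC, hbound⟩ := exists_abs_sum_compensatedTerm_le h1 h2
  have hg : IntegrableOn (fun t : ℝ => C * ‖log t * (1 + t ^ 2)⁻¹‖) (Ioi 0) :=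
    integrableOn_log_mul_inv_one_add_sq.norm.const_mul C
  have hle (N : ℕ) (t : ℝ) : ‖log t * ∑ k ∈ Finset.range N, compensatedTerm a k t‖ ≤
      C * ‖log t * (1 + t ^ 2)⁻¹‖ := by
    rw [norm_mul, norm_mul, norm_of_nonneg (by positivity : 0 ≤ (1 + t ^ 2)⁻¹), mul_left_comm]
    exact mul_le_mul_of_nonneg_left (hbound N t) (norm_nonneg _)
  have hlim (t : ℝ) (ht : t ∈ Ioi (0 : ℝ)) := (tendsto_sum_compensatedTerm (a := a) ht).const_mul
    (log t)
  have hmeas (N : ℕ) : AEStronglyMeasurable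
      (fun t => log t * ∑ k ∈ Finset.range N, compensatedTerm a k t)
      (volume.restrict (Ioi 0)) := by
    refine (measurable_log.mul ?_).aestronglyMeasurable
    unfold compensatedTerm cauchyKernel
    fun_prop
  constructor
  · refine hg.mono' (measurable_log.mul ?_).aestronglyMeasurable ?_
    · fun_prop
    · filter_upwards [ae_restrict_mem measurableSet_Ioi] with t ht
      -- The dominating function of the partial sums also bounds their pointwise limit, which gives
      -- absolute convergence.
      exact le_of_tendsto (hlim t ht).norm (Eventually.of_forall fun N => hle N t)
  · have hT := tendsto_integral_of_dominated_convergence _ hmeas hg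
      (fun N => Eventually.of_forall (hle N))
      ((ae_restrict_mem measurableSet_Ioi).mono hlim)
    refine tendsto_nhds_unique (hT.comp (tendsto_add_atTop_nat 1)) ?_
    have hα : |a / (2 * π)| < 1 / 2 := by
      rw [abs_div, abs_of_pos two_pi_pos, div_lt_iff₀ two_pi_pos]
      have := abs_lt.2 ⟨h1, h2⟩
      linarith
    have hα1 : 0 < 1 / 2 + a / (2 * π) := by linarith [(abs_lt.1 hα).1]
    have hα2 : 0 < 1 / 2 - a / (2 * π) := by linarith [(abs_lt.1 hα).2]
    have hG := (((BohrMollerup.tendsto_log_gamma hα1).sub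
      (BohrMollerup.tendsto_log_gamma hα2)).add ((tendsto_log_nat_add_one_sub_log.const_add
        (log (2 * π))).const_mul (a / π))).const_mul (π / 2)
    refine (hG.congr fun n => ?_).trans_eq ?_
    · rw [Function.comp, integral_log_mul_sum_compensatedTerm h1 h2, sum_log_sub_log_eq h1 h2]
    · rw [log_div (mul_ne_zero (by positivity) (Gamma_pos_of_pos hα1).ne')
        (Gamma_pos_of_pos hα2).ne', log_mul (by positivity) (Gamma_pos_of_pos hα1).ne',
        log_rpow two_pi_pos]
      congr 1; ring

/-! ### Return to the variable y -/

theorem image_exp_neg_Ioi : (fun t : ℝ => exp (-t)) '' Ioi 0 = Ioo 0 1 := by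
  ext y
  constructor
  · rintro ⟨t, ht, rfl⟩
    exact ⟨exp_pos _, by simpa using ht⟩
  · rintro ⟨h0, h1⟩
    exact ⟨-log y, by simpa using log_neg h0 h1, by simp [exp_log h0]⟩

theorem vardi_general {a : ℝ} (h1 : -π < a) (h2 : a < π) :
    IntervalIntegrable
        (fun y : ℝ => log (log (1 / y)) * sin a / (1 + 2 * y * cos a + y ^ 2)) volume 0 1 ∧
      ∫ y in (0 : ℝ)..1, log (log (1 / y)) * sin a / (1 + 2 * y * cos a + y ^ 2) =
        π / 2 * log ((2 * π) ^ (a / π) * Gamma (1 / 2 + a / (2 * π))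
          / Gamma (1 / 2 - a / (2 * π))) := by
  have hd (t : ℝ) (_ : t ∈ Ioi (0 : ℝ)) :
      HasDerivWithinAt (fun t : ℝ => exp (-t)) (-exp (-t)) (Ioi 0) t := by
    simpa using ((hasDerivAt_neg t).exp).hasDerivWithinAt
  have hinj : InjOn (fun t : ℝ => exp (-t)) (Ioi 0) := fun x _ y _ h => by simpa using h
  have hcongr : EqOn (fun t : ℝ => |-exp (-t)| • (log (log (1 / exp (-t))) * sin a /
      (1 + 2 * exp (-t) * cos a + exp (-t) ^ 2)))
      (fun t => log t * (sin a / (2 * (cosh t + cos a)))) (Ioi 0) := fun t _ => by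
    -- The factor `exp (-t)` extracted here cancels the Jacobian.
    have e : 1 + 2 * exp (-t) * cos a + exp (-t) ^ 2 = exp (-t) * (2 * (cosh t + cos a)) := by
      rw [cosh_eq]
      have : exp (-t) * exp t = 1 := by rw [← exp_add]; simp
      linear_combination -this
    simp only [abs_neg, abs_of_pos (exp_pos _), smul_eq_mul, one_div, log_inv, log_exp, neg_neg, e]
    rw [← mul_div_assoc, mul_div_mul_left _ _ (exp_pos _).ne', mul_div_assoc]
  obtain ⟨hI, hE⟩ := integral_log_mul_sin_div_cosh h1 h2
  constructor
  · rw [intervalIntegrable_iff_integrableOn_Ioo_of_le zero_le_one, ← image_exp_neg_Ioi,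
      integrableOn_image_iff_integrableOn_abs_deriv_smul measurableSet_Ioi hd hinj]
    exact hI.congr_fun hcongr.symm measurableSet_Ioi
  · rw [intervalIntegral.integral_of_le zero_le_one, integral_Ioc_eq_integral_Ioo,
      ← image_exp_neg_Ioi, integral_image_eq_integral_abs_deriv_smul measurableSet_Ioi hd hinj,
      setIntegral_congr_fun measurableSet_Ioi hcongr, hE]

/-! ### Special values -/

theorem vardi_div_sin {a : ℝ} (h1 : 0 < a) (h2 : a < π) :
    IntervalIntegrable
        (fun y : ℝ => log (log (1 / y)) / (1 + 2 * y * cos a + y ^ 2)) volume 0 1 ∧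
      ∫ y in (0 : ℝ)..1, log (log (1 / y)) / (1 + 2 * y * cos a + y ^ 2) =
        π / (2 * sin a) * log ((2 * π) ^ (a / π) * Gamma (1 / 2 + a / (2 * π))
          / Gamma (1 / 2 - a / (2 * π))) := by
  obtain ⟨hI, hE⟩ := vardi_general (by linarith [pi_pos] : -π < a) h2
  have hs := sin_pos_of_pos_of_lt_pi h1 h2
  have e : (fun y : ℝ => log (log (1 / y)) / (1 + 2 * y * cos a + y ^ 2)) = fun y =>
      (sin a)⁻¹ * (log (log (1 / y)) * sin a / (1 + 2 * y * cos a + y ^ 2)) := by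
    ext y; field_simp
  rw [e]
  refine ⟨hI.const_mul _, ?_⟩
  rw [intervalIntegral.integral_const_mul, hE]
  field_simp

theorem mainTheorem3 :
    -- the general evaluation of F(a), for -π < a < π
    (∀ a : ℝ, -π < a → a < π →
      IntervalIntegrable
        (fun y : ℝ => log (log (1 / y)) * sin a / (1 + 2 * y * cos a + y ^ 2)) volume 0 1 ∧
      ∫ y in (0 : ℝ)..1, log (log (1 / y)) * sin a / (1 + 2 * y * cos a + y ^ 2) =
        π / 2 * log ((2 * π) ^ (a / π) * Gamma (1 / 2 + a / (2 * π))
          / Gamma (1 / 2 - a / (2 * π)))) ∧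
    -- a = π/2: Vardi's integral
    (IntervalIntegrable (fun y : ℝ => log (log (1 / y)) / (1 + y ^ 2)) volume 0 1 ∧
      ∫ y in (0 : ℝ)..1, log (log (1 / y)) / (1 + y ^ 2) =
        π / 2 * log (√(2 * π) * Gamma (3 / 4) / Gamma (1 / 4))) ∧
    -- a = π/3
    (IntervalIntegrable (fun y : ℝ => log (log (1 / y)) / (1 + y + y ^ 2)) volume 0 1 ∧
      ∫ y in (0 : ℝ)..1, log (log (1 / y)) / (1 + y + y ^ 2) =
        π / √3 * log ((2 * π) ^ (1 / 3 : ℝ) * Gamma (2 / 3) / Gamma (1 / 3))) ∧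
    -- a = 2π/3, in both forms
    (IntervalIntegrable (fun y : ℝ => log (log (1 / y)) / (1 - y + y ^ 2)) volume 0 1 ∧
      ∫ y in (0 : ℝ)..1, log (log (1 / y)) / (1 - y + y ^ 2) =
        π / √3 * log ((2 * π) ^ (2 / 3 : ℝ) * Gamma (5 / 6) / Gamma (1 / 6)) ∧
      ∫ y in (0 : ℝ)..1, log (log (1 / y)) / (1 - y + y ^ 2) =
        2 * π / √3 * (5 / 6 * log (2 * π) - log (Gamma (1 / 6)))) := by
  have hpi := pi_pos
  have hs3 : 0 < √3 := by positivity
  have hc : cos (2 * π / 3) = -(1 / 2) := by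
    rw [show 2 * π / 3 = π - π / 3 by ring, cos_pi_sub, cos_pi_div_three]
  have hs : sin (2 * π / 3) = √3 / 2 := by
    rw [show 2 * π / 3 = π - π / 3 by ring, sin_pi_sub, sin_pi_div_three]
  refine ⟨fun a h1 h2 => vardi_general h1 h2, ?_, ?_, ?_⟩
  · have h := vardi_div_sin (a := π / 2) (by positivity) (by linarith)
    simp only [cos_pi_div_two, sin_pi_div_two, mul_zero, add_zero, mul_one,
      show π / 2 / π = 1 / 2 by field_simp, show π / 2 / (2 * π) = 1 / 4 by field_simp; norm_num,
      ← sqrt_eq_rpow] at h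
    norm_num at h ⊢
    exact h
  · have h := vardi_div_sin (a := π / 3) (by positivity) (by linarith)
    have e (y : ℝ) : 1 + 2 * y * (1 / 2) + y ^ 2 = 1 + y + y ^ 2 := by ring
    simp only [cos_pi_div_three, sin_pi_div_three, e, show π / 3 / π = 1 / 3 by field_simp,
      show π / 3 / (2 * π) = 1 / 6 by field_simp; norm_num,
      show (1 / 2 + 1 / 6 : ℝ) = 2 / 3 by norm_num, show (1 / 2 - 1 / 6 : ℝ) = 1 / 3 by norm_num,
      mul_div_cancel₀ (√3) (two_ne_zero' ℝ)] at h
    exact h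
  · have h := vardi_div_sin (a := 2 * π / 3) (by positivity) (by linarith)
    have e (y : ℝ) : 1 + 2 * y * -(1 / 2) + y ^ 2 = 1 - y + y ^ 2 := by ring
    simp only [hc, hs, e, show 2 * π / 3 / π = 2 / 3 by field_simp,
      show 2 * π / 3 / (2 * π) = 1 / 3 by field_simp,
      show (1 / 2 + 1 / 3 : ℝ) = 5 / 6 by norm_num, show (1 / 2 - 1 / 3 : ℝ) = 1 / 6 by norm_num,
      mul_div_cancel₀ (√3) (two_ne_zero' ℝ)] at h
    refine ⟨h.1, h.2, h.2.trans ?_⟩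
    -- Reflection gives Γ(1/6)Γ(5/6) = π / sin(π/6) = 2π, which eliminates Γ(5/6): the coefficient
    -- of log(2π) becomes 2/3 + 1 = 2 · 5/6.
    have hG := Gamma_mul_Gamma_one_sub (1 / 6)
    rw [show (1 - 1 / 6 : ℝ) = 5 / 6 by norm_num, show π * (1 / 6) = π / 6 by ring,
      sin_pi_div_six, show π / (1 / 2) = 2 * π by ring] at hG
    have g1 : 0 < Gamma (1 / 6) := Gamma_pos_of_pos (by norm_num)
    have g5 : 0 < Gamma (5 / 6) := Gamma_pos_of_pos (by norm_num)
    have hL : log (Gamma (1 / 6)) + log (Gamma (5 / 6)) = log (2 * π) := by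
      rw [← log_mul g1.ne' g5.ne', hG]
    rw [log_div (by positivity) g1.ne', log_mul (by positivity) g5.ne', log_rpow two_pi_pos]
    rw [show log (Gamma (5 / 6)) = log (2 * π) - log (Gamma (1 / 6)) by linarith]
    ring
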